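/- Throughout, complex manifolds are Hausdorff, second countable and of pure (finite) dimension, connected spaces are nonempty, and complex submanifolds are embedded but not necessarily closed. Theorem 1.2. Let $M_0$ be a complex manifold and let $S$ be a connected $n$-dimensional complex submanifold of $M_0$. Then there exists a leaf extension of $S$ in $M_0$, that is, a connected $n$-dimensional complex manifold $M$ together with a holomorphic immersion $\phi: M\to M_0$ such that $\phi(M)\supset S$ and such that the following universal property is satisfied: for every connected $n$-dimensional complex manifold $M_1$ and every holomorphic immersion $\phi_1: M_1\to M_0$ such that $\phi_1(U_1)\subset\phi(M)$ for some nonempty open subset $U_1$ of $M_1$, there is a unique holomorphic map $\rho_{\phi_1}: M_1\to M$ with $\phi_1=\phi\circ\rho_{\phi_1}$. -/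

import Mathlib

open scoped Manifold ContDiff

universe u v w

/-- The model space `ℂⁿ` of `n`-dimensional complex manifolds. -/
abbrev CSpace (n : ℕ) : Type := EuclideanSpace ℂ (Fin n)

/-- `M`, with its given topology and charts, is an `n`-dimensional complex manifold: it is Hausdorff
and second countable, and the changes of charts are holomorphic (`ω` means analytic, here over `ℂ`).
Connectedness is not included. -/
structure IsComplexManifold (n : ℕ) (M : Type*) [TopologicalSpace M]
    [ChartedSpace (CSpace n) M] : Prop where
  t2 : T2Space M
  secondCountable : SecondCountableTopology M
  isManifold : IsManifold 𝓘(ℂ, CSpace n) ω M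

/-- Holomorphic maps from an `m`-dimensional to an `n`-dimensional complex manifold. -/
def IsHolomorphic (m n : ℕ) {M N : Type*} [TopologicalSpace M] [ChartedSpace (CSpace m) M]
    [TopologicalSpace N] [ChartedSpace (CSpace n) N] (f : M → N) : Prop :=
  ContMDiff 𝓘(ℂ, CSpace m) 𝓘(ℂ, CSpace n) ω f

/-- Holomorphic immersions: in suitable holomorphic charts around `x` and `f x`, the map `f` is
`u ↦ (u, 0)`. Such a map is holomorphic (`Manifold.IsImmersion.contMDiff`). -/
def IsHolomorphicImmersion (m n : ℕ) {M N : Type*} [TopologicalSpace M]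
    [ChartedSpace (CSpace m) M] [TopologicalSpace N] [ChartedSpace (CSpace n) N]
    (f : M → N) : Prop :=
  Manifold.IsImmersion 𝓘(ℂ, CSpace m) 𝓘(ℂ, CSpace n) ω f

/-- `S` is an `n`-dimensional complex (embedded, not necessarily closed) submanifold of the
`N`-dimensional complex manifold `M₀`: around each of its points there is a holomorphic chart `e`
of `M₀` in which `S` is an `n`-dimensional complex linear subspace `L` of `ℂᴺ`, that is,
`q ∈ S ↔ e q ∈ L` for all `q` in the domain of `e`. -/
def IsComplexSubmanifold (N n : ℕ) {M₀ : Type*} [TopologicalSpace M₀]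
    [ChartedSpace (CSpace N) M₀] (S : Set M₀) : Prop :=
  ∀ p ∈ S, ∃ e ∈ IsManifold.maximalAtlas 𝓘(ℂ, CSpace N) ω M₀, p ∈ e.source ∧
    ∃ L : Submodule ℂ (CSpace N), Module.finrank ℂ L = n ∧ ∀ q ∈ e.source, q ∈ S ↔ e q ∈ L

/-- `(M, φ)` is an `n`-dimensional complex leaf pair of the `N`-dimensional complex manifold `M₀`.
The universe `w` of the test manifolds `M₁` is arbitrary. -/
structure IsComplexLeafPair (N n : ℕ) {M₀ : Type u} [TopologicalSpace M₀]
    [ChartedSpace (CSpace N) M₀] (M : Type v) [TopologicalSpace M] [ChartedSpace (CSpace n) M]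
    (φ : M → M₀) : Prop where
  isComplexManifold : IsComplexManifold n M
  connected : ConnectedSpace M
  isImmersion : IsHolomorphicImmersion n N φ
  universal : ∀ (M₁ : Type w) [TopologicalSpace M₁] [ChartedSpace (CSpace n) M₁],
    IsComplexManifold n M₁ → ConnectedSpace M₁ →
    ∀ φ₁ : M₁ → M₀, IsHolomorphicImmersion n N φ₁ →
      (∃ U₁ : Set M₁, IsOpen U₁ ∧ U₁.Nonempty ∧ φ₁ '' U₁ ⊆ Set.range φ) →
      ∃! ρ : M₁ → M, IsHolomorphic n n ρ ∧ φ₁ = φ ∘ ρ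

/-- `(M, φ)` is a leaf extension in `M₀` of the `n`-dimensional submanifold `S`. -/
structure IsLeafExtension (N n : ℕ) {M₀ : Type u} [TopologicalSpace M₀]
    [ChartedSpace (CSpace N) M₀] (S : Set M₀) (M : Type v) [TopologicalSpace M]
    [ChartedSpace (CSpace n) M] (φ : M → M₀) : Prop where
  isLeafPair : IsComplexLeafPair.{u, v, w} N n M φ
  subset_range : S ⊆ Set.range φ

/-! The leaf extension is built by analytic continuation of germs. All germs of `n`-dimensional
slices of `M₀`, at all points, form a space `SliceGerm` in which the germs of one slice make up an
open set, with the coordinates of that slice as chart. The map `pt` is then a holomorphic immersion,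
and the leaf extension of `S` is the connected component containing the germs of `S`.

A germ at `p` is stored as the filter `𝓝[d.slice] p`, which determines the slice near `p`. The germ
of an immersion `φ₁` at `x` is then `map φ₁ (𝓝 x)`. This defines `lift`, which restricts to the only
possible `ρ`.

Two facts carry the geometry: an inclusion of germs of equal dimension is an equality
(`nhdsWithin_slice_eq_of_le`), and slices obey an identity theorem
(`mapsTo_slice_of_isPreconnected`). Together they make `SliceGerm` Hausdorff. A component is second
countable by Poincaré–Volterra, applied to `pt`. For the universal property, `lift` is continuous,
so by connectedness of `M₁` it suffices that one germ of `φ₁` lies in the leaf. As the leaf is a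
countable union of compact sets, Baire's theorem provides such a germ (`exists_lift_mem_leaf`). -/

open Set Filter Topology

/-! ### Topology: the Poincaré–Volterra theorem -/

/-- Local step of the Poincaré–Volterra theorem: a point of `X` has arbitrarily small open
neighbourhoods which are connected components of preimages of basic open sets. -/
theorem exists_mem_basis_connectedComponentIn_subset {X Y : Type*} [TopologicalSpace X]
    [TopologicalSpace Y] [T2Space X] [LocallyCompactSpace X] [T2Space Y] {f : X → Y}
    (hf : Continuous f) {B : Set (Set Y)} (hB : TopologicalSpace.IsTopologicalBasis B) {x : X}
    {O : Set X} (hO : O ∈ 𝓝 x) (hinj : InjOn f O) :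
    ∃ U ∈ B, f x ∈ U ∧ connectedComponentIn (f ⁻¹' U) x ⊆ O := by
  obtain ⟨K, hK, hKO, hKc⟩ := local_compact_nhds hO
  have hxK : x ∈ interior K := mem_interior_iff_mem_nhds.2 hK
  have hbd : IsClosed (f '' (K \ interior K)) :=
    ((hKc.diff isOpen_interior).image hf).isClosed
  have hfx : f x ∈ (f '' (K \ interior K))ᶜ := by
    rintro ⟨y, ⟨hyK, hyi⟩, hy⟩
    exact hyi (hinj (hKO hyK) (hKO (interior_subset hxK)) hy ▸ hxK)
  obtain ⟨U, hU, hxU, hUs⟩ := hB.exists_subset_of_mem_open hfx hbd.isOpen_compl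
  refine ⟨U, hU, hxU, ?_⟩
  -- `U` avoids the image of the frontier of `K`, so a connected subset of `f ⁻¹' U` cannot leave
  -- `K`.
  have hsub : connectedComponentIn (f ⁻¹' U) x ⊆ interior K ∪ Kᶜ := by
    intro y hy
    by_cases hyK : y ∈ K
    · left
      by_contra hyi
      exact hUs (connectedComponentIn_subset (f ⁻¹' U) x hy) ⟨y, ⟨hyK, hyi⟩, rfl⟩
    · exact Or.inr hyK
  refine (isPreconnected_connectedComponentIn.subset_left_of_subset_union isOpen_interior
    hKc.isClosed.isOpen_compl ?_ hsub ⟨x, mem_connectedComponentIn hxU, hxK⟩).trans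
    (interior_subset.trans hKO)
  exact disjoint_compl_right.mono_left interior_subset

/-- A preconnected space is covered by countably many members of an open cover, provided that each
member of the cover meets only countably many others. -/
theorem exists_countable_subcover_of_countable_meets {X : Type*} [TopologicalSpace X]
    [PreconnectedSpace X] {𝒱 : Set (Set X)} (hopen : ∀ V ∈ 𝒱, IsOpen V) (hcov : ⋃₀ 𝒱 = univ)
    (hmeet : ∀ V ∈ 𝒱, {W ∈ 𝒱 | (V ∩ W).Nonempty}.Countable) :
    ∃ 𝒲 ⊆ 𝒱, 𝒲.Countable ∧ ⋃₀ 𝒲 = univ := by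
  rcases isEmpty_or_nonempty X with hX | ⟨⟨x⟩⟩
  · exact ⟨∅, empty_subset _, countable_empty, Subsingleton.elim _ _⟩
  obtain ⟨V₀, hV₀, hx⟩ : x ∈ ⋃₀ 𝒱 := hcov ▸ mem_univ x
  let next : Set (Set X) → Set (Set X) := fun 𝒲 ↦ ⋃ V ∈ 𝒲, {W ∈ 𝒱 | (V ∩ W).Nonempty}
  let stage : ℕ → Set (Set X) := fun k ↦ next^[k] {V₀}
  have hsucc : ∀ k, stage (k + 1) = next (stage k) := fun k ↦ Function.iterate_succ_apply' _ _ _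
  have hstage : ∀ k, stage k ⊆ 𝒱 ∧ (stage k).Countable := by
    intro k
    induction k with
    | zero => exact ⟨singleton_subset_iff.2 hV₀, countable_singleton V₀⟩
    | succ k ih =>
      rw [hsucc]
      exact ⟨iUnion₂_subset fun V _ W hW ↦ hW.1,
        ih.2.biUnion fun V hV ↦ hmeet V (ih.1 hV)⟩
  have hA : IsClopen (⋃₀ ⋃ k, stage k) := by
    constructor
    · rw [← isOpen_compl_iff, isOpen_iff_forall_mem_open]
      intro y hy
      obtain ⟨W, hW, hyW⟩ : y ∈ ⋃₀ 𝒱 := hcov ▸ mem_univ y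
      refine ⟨W, fun z hzW ↦ ?_, hopen W hW, hyW⟩
      rintro ⟨V, hV, hzV⟩
      obtain ⟨k, hk⟩ := mem_iUnion.1 hV
      refine hy ⟨W, mem_iUnion.2 ⟨k + 1, ?_⟩, hyW⟩
      rw [hsucc]
      exact mem_iUnion₂.2 ⟨V, hk, hW, z, hzV, hzW⟩
    · refine isOpen_sUnion fun V hV ↦ ?_
      obtain ⟨k, hk⟩ := mem_iUnion.1 hV
      exact hopen V ((hstage k).1 hk)
  refine ⟨⋃ k, stage k, iUnion_subset fun k ↦ (hstage k).1,
    countable_iUnion fun k ↦ (hstage k).2, hA.eq_univ ⟨x, V₀, ?_, hx⟩⟩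
  exact mem_iUnion.2 ⟨0, rfl⟩

/-- The **Poincaré–Volterra theorem**: a connected, locally connected, locally compact Hausdorff
space which is locally second countable and maps continuously and locally injectively to a second
countable Hausdorff space is second countable. -/
theorem secondCountableTopology_of_locally_injective {X Y : Type*} [TopologicalSpace X]
    [TopologicalSpace Y] [T2Space X] [LocallyCompactSpace X] [LocallyConnectedSpace X]
    [PreconnectedSpace X] [T2Space Y] [SecondCountableTopology Y] {f : X → Y}
    (hf : Continuous f)
    (hloc : ∀ x, ∃ O ∈ 𝓝 x, SecondCountableTopology O ∧ InjOn f O) :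
    SecondCountableTopology X := by
  let B := TopologicalSpace.countableBasis Y
  have hB : TopologicalSpace.IsTopologicalBasis B := TopologicalSpace.isBasis_countableBasis Y
  let 𝒱 : Set (Set X) := {V | SecondCountableTopology V ∧
    ∃ U ∈ B, ∃ x ∈ f ⁻¹' U, V = connectedComponentIn (f ⁻¹' U) x}
  have hopen : ∀ V ∈ 𝒱, IsOpen V := by
    rintro V ⟨-, U, hU, x, -, rfl⟩
    exact ((hB.isOpen hU).preimage hf).connectedComponentIn
  have hcov : ⋃₀ 𝒱 = univ := by
    refine eq_univ_of_forall fun x ↦ ?_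
    obtain ⟨O, hO, hOc, hinj⟩ := hloc x
    obtain ⟨U, hU, hxU, hUO⟩ :=
      exists_mem_basis_connectedComponentIn_subset hf hB hO hinj
    refine ⟨_, ⟨?_, U, hU, x, hxU, rfl⟩, mem_connectedComponentIn hxU⟩
    exact (IsEmbedding.inclusion hUO).secondCountableTopology
  have hmeet : ∀ V ∈ 𝒱, {W ∈ 𝒱 | (V ∩ W).Nonempty}.Countable := by
    intro V hV
    have : SecondCountableTopology V := hV.1
    have hsub : {W ∈ 𝒱 | (V ∩ W).Nonempty} ⊆
        ⋃ U ∈ B, {W | (∃ x ∈ f ⁻¹' U, W = connectedComponentIn (f ⁻¹' U) x) ∧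
          (V ∩ W).Nonempty} := by
      rintro W ⟨⟨-, U, hU, x, hx, hW⟩, hVW⟩
      exact mem_iUnion₂.2 ⟨U, hU, ⟨x, hx, hW⟩, hVW⟩
    refine Countable.mono hsub
      ((TopologicalSpace.countable_countableBasis Y).biUnion fun U hU ↦ ?_)
    set 𝒞 : Set (Set X) := {W | (∃ x ∈ f ⁻¹' U, W = connectedComponentIn (f ⁻¹' U) x) ∧
          (V ∩ W).Nonempty}
    -- For a fixed `U`, distinct components of `f ⁻¹' U` are disjoint, and the second countable `V`
    -- contains only countably many disjoint nonempty open sets.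
    have hdisj : 𝒞.PairwiseDisjoint (fun W ↦ (Subtype.val ⁻¹' W : Set V)) := by
      rintro _ ⟨⟨x, hx, rfl⟩, -⟩ _ ⟨⟨y, hy, rfl⟩, -⟩ hne
      refine Disjoint.preimage _ ?_
      by_contra h
      obtain ⟨z, hzx, hzy⟩ := not_disjoint_iff.1 h
      exact hne ((connectedComponentIn_eq hzx).trans (connectedComponentIn_eq hzy).symm)
    refine hdisj.countable_of_isOpen ?_ ?_
    · rintro _ ⟨⟨x, hx, rfl⟩, -⟩
      exact ((hB.isOpen hU).preimage hf).connectedComponentIn.preimage continuous_subtype_val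
    · rintro W ⟨-, z, hzV, hzW⟩
      exact ⟨⟨z, hzV⟩, hzW⟩
  obtain ⟨𝒲, h𝒲, hcount, hun⟩ := exists_countable_subcover_of_countable_meets hopen hcov hmeet
  have := hcount.to_subtype
  have hsc : ∀ V : 𝒲, SecondCountableTopology (V : Set X) := fun V ↦ (h𝒲 V.2).1
  refine TopologicalSpace.secondCountableTopology_of_countable_cover
    (fun V : 𝒲 ↦ hopen V (h𝒲 V.2)) ?_
  rw [← sUnion_eq_iUnion, hun]

/-! ### Slices of `M₀` and their germs -/

/-- A holomorphic chart of `M₀` together with a split injection of `ℂⁿ` into `ℂᴺ`; it cuts out a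
nonempty `n`-dimensional slice of `M₀`, the preimage of the range of the injection. -/
structure SliceChart (N n : ℕ) (M₀ : Type*) [TopologicalSpace M₀] [ChartedSpace (CSpace N) M₀] where
  chart : OpenPartialHomeomorph M₀ (CSpace N)
  chart_mem : chart ∈ IsManifold.maximalAtlas 𝓘(ℂ, CSpace N) ω M₀
  incl : CSpace n →L[ℂ] CSpace N
  proj : CSpace N →L[ℂ] CSpace n
  proj_incl : ∀ v, proj (incl v) = v
  center : M₀
  center_mem_source : center ∈ chart.source
  incl_proj_center : incl (proj (chart center)) = chart center

namespace SliceChart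

variable {N n : ℕ} {M₀ : Type*} [TopologicalSpace M₀] [ChartedSpace (CSpace N) M₀]
  (d d' : SliceChart N n M₀)

/-- The slice cut out by a slice chart. -/
def slice : Set M₀ := {q | q ∈ d.chart.source ∧ d.incl (d.proj (d.chart q)) = d.chart q}

/-- The coordinate map of a slice. -/
noncomputable def coord (q : M₀) : CSpace n := d.proj (d.chart q)

/-- The parametrization of a slice. -/
noncomputable def param (v : CSpace n) : M₀ := d.chart.symm (d.incl v)

/-- The domain of the parametrization of a slice. -/
def dom : Set (CSpace n) := d.incl ⁻¹' d.chart.target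

theorem center_mem : d.center ∈ d.slice := ⟨d.center_mem_source, d.incl_proj_center⟩

theorem isOpen_dom : IsOpen d.dom := d.chart.open_target.preimage d.incl.continuous

theorem chart_param {v : CSpace n} (hv : v ∈ d.dom) : d.chart (d.param v) = d.incl v :=
  d.chart.right_inv hv

theorem coord_param {v : CSpace n} (hv : v ∈ d.dom) : d.coord (d.param v) = v := by
  rw [coord, d.chart_param hv, d.proj_incl]

theorem param_mem {v : CSpace n} (hv : v ∈ d.dom) : d.param v ∈ d.slice :=
  ⟨d.chart.map_target hv, by rw [d.chart_param hv, d.proj_incl]⟩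

theorem incl_coord {q : M₀} (hq : q ∈ d.slice) : d.incl (d.coord q) = d.chart q := hq.2

theorem coord_mem {q : M₀} (hq : q ∈ d.slice) : d.coord q ∈ d.dom := by
  rw [dom, mem_preimage, d.incl_coord hq]
  exact d.chart.map_source hq.1

theorem param_coord {q : M₀} (hq : q ∈ d.slice) : d.param (d.coord q) = q := by
  rw [param, d.incl_coord hq, d.chart.left_inv hq.1]

theorem contMDiffOn_coord :
    ContMDiffOn 𝓘(ℂ, CSpace N) 𝓘(ℂ, CSpace n) ω d.coord d.chart.source :=
  d.proj.contMDiff.comp_contMDiffOn (contMDiffOn_of_mem_maximalAtlas d.chart_mem)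

theorem contMDiffOn_param : ContMDiffOn 𝓘(ℂ, CSpace n) 𝓘(ℂ, CSpace N) ω d.param d.dom :=
  (contMDiffOn_symm_of_mem_maximalAtlas d.chart_mem).comp d.incl.contMDiff.contMDiffOn
    fun _ hv ↦ hv

theorem contMDiffAt_coord {q : M₀} (hq : q ∈ d.chart.source) :
    ContMDiffAt 𝓘(ℂ, CSpace N) 𝓘(ℂ, CSpace n) ω d.coord q :=
  d.contMDiffOn_coord.contMDiffAt (d.chart.open_source.mem_nhds hq)

theorem contMDiffAt_param {v : CSpace n} (hv : v ∈ d.dom) :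
    ContMDiffAt 𝓘(ℂ, CSpace n) 𝓘(ℂ, CSpace N) ω d.param v :=
  d.contMDiffOn_param.contMDiffAt (d.isOpen_dom.mem_nhds hv)

/-- `param` and `coord` are continuous and mutually inverse between `dom` and the slice. This turns
statements about germs into statements about neighbourhoods in `ℂⁿ`. -/
theorem map_param_nhds {v : CSpace n} (hv : v ∈ d.dom) :
    map d.param (𝓝 v) = 𝓝[d.slice] (d.param v) := by
  apply le_antisymm
  · refine tendsto_nhdsWithin_iff.2 ⟨(d.contMDiffAt_param hv).continuousAt, ?_⟩
    filter_upwards [d.isOpen_dom.mem_nhds hv] with w hw using d.param_mem hw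
  · have h1 : map d.coord (𝓝[d.slice] (d.param v)) ≤ 𝓝 v := by
      have := (d.contMDiffAt_coord (d.param_mem hv).1).continuousAt
      rw [ContinuousAt, d.coord_param hv] at this
      exact this.mono_left nhdsWithin_le_nhds
    calc 𝓝[d.slice] (d.param v) = map (d.param ∘ d.coord) (𝓝[d.slice] (d.param v)) := by
          conv_lhs => rw [← map_id (f := 𝓝[d.slice] (d.param v))]
          refine Filter.map_congr ?_
          filter_upwards [self_mem_nhdsWithin] with q hq using (d.param_coord hq).symm
      _ = map d.param (map d.coord (𝓝[d.slice] (d.param v))) := map_map.symm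
      _ ≤ map d.param (𝓝 v) := map_mono h1

theorem contDiffAt_transition {v : CSpace n} (hv : v ∈ d.dom) (h : d.param v ∈ d'.chart.source) :
    ContDiffAt ℂ ω (d'.coord ∘ d.param) v :=
  contMDiffAt_iff_contDiffAt.1
    (ContMDiffAt.comp v (d'.contMDiffAt_coord h) (d.contMDiffAt_param hv))

/-- A slice contained in another slice of the same dimension is open in it. -/
theorem nhdsWithin_slice_eq_of_le {p : M₀} (hp : p ∈ d.slice) (hp' : p ∈ d'.slice)
    (hle : 𝓝[d'.slice] p ≤ 𝓝[d.slice] p) : 𝓝[d'.slice] p = 𝓝[d.slice] p := by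
  have hv' := d'.coord_mem hp'
  have hpv' := d'.param_coord hp'
  set v' := d'.coord p with hv'def
  set h : CSpace n → CSpace n := d.coord ∘ d'.param with hdef
  have hhv : h v' = d.coord p := by simp [hdef, hpv']
  have hmem : ∀ᶠ w in 𝓝 v', d'.param w ∈ d.slice := by
    have : map d'.param (𝓝 v') ≤ 𝓝[d.slice] p := by rw [d'.map_param_nhds hv', hpv']; exact hle
    exact this self_mem_nhdsWithin
  have hh : ContDiffAt ℂ ω h v' := d'.contDiffAt_transition d hv' (by rw [hpv']; exact hp.1)
  have hk : ContDiffAt ℂ ω (d'.coord ∘ d.param) (h v') := by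
    rw [hhv]
    exact d.contDiffAt_transition d' (d.coord_mem hp) (by rw [d.param_coord hp]; exact hp'.1)
  have hkh : (d'.coord ∘ d.param) ∘ h =ᶠ[𝓝 v'] id := by
    filter_upwards [hmem, d'.isOpen_dom.mem_nhds hv'] with w hw hw'
    simp [hdef, d.param_coord hw, d'.coord_param hw']
  have hω : (ω : WithTop ℕ∞) ≠ 0 := by simp
  -- The derivative of `h` has a left inverse; source and target both have dimension `n`, so it is
  -- also surjective and `h` is open at `v'`.
  have hcomp : (fderiv ℂ (d'.coord ∘ d.param) (h v')).comp (fderiv ℂ h v') =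
      ContinuousLinearMap.id ℂ _ := by
    rw [← fderiv_comp v' (hk.differentiableAt hω) (hh.differentiableAt hω), hkh.fderiv_eq,
      fderiv_id]
  have hinj : Function.Injective (fderiv ℂ h v') := fun a b hab ↦ by
    have := congrArg (fderiv ℂ (d'.coord ∘ d.param) (h v')) hab
    rwa [← ContinuousLinearMap.comp_apply, ← ContinuousLinearMap.comp_apply, hcomp] at this
  have hsurj : (fderiv ℂ h v').range = ⊤ :=
    LinearMap.range_eq_top.2 (LinearMap.injective_iff_surjective.1 hinj)
  have hmap : map h (𝓝 v') = 𝓝 (h v') :=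
    (hh.hasStrictFDerivAt hω).map_nhds_eq_of_surj hsurj
  calc 𝓝[d'.slice] p = map d'.param (𝓝 v') := by rw [d'.map_param_nhds hv', hpv']
    _ = map (d.param ∘ h) (𝓝 v') := Filter.map_congr <| by
        filter_upwards [hmem] with w hw using (d.param_coord hw).symm
    _ = map d.param (𝓝 (h v')) := by rw [← map_map, hmap]
    _ = 𝓝[d.slice] p := by
        rw [hhv, d.map_param_nhds (d.coord_mem hp), d.param_coord hp]

/-- The identity theorem for slices: if the parametrization of one slice sends a preconnected set
`B` into the chart domain of another slice and the two slices have the same germ at a point of `B`,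
then `B` is sent into the other slice. -/
theorem mapsTo_slice_of_isPreconnected {B : Set (CSpace n)} (hB : IsPreconnected B)
    (hBd : B ⊆ d.dom) (hBd' : MapsTo d.param B d'.chart.source) {v : CSpace n} (hv : v ∈ B)
    (heq : 𝓝[d.slice] (d.param v) = 𝓝[d'.slice] (d.param v)) : MapsTo d.param B d'.slice := by
  let g : CSpace N → CSpace N := fun z ↦ d'.incl (d'.proj z) - z
  have hg : AnalyticOnNhd ℂ (g ∘ d'.chart ∘ d.param) B := by
    intro w hw
    have h1 : ContMDiffAt 𝓘(ℂ, CSpace n) 𝓘(ℂ, CSpace N) ω (d'.chart ∘ d.param) w :=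
      ContMDiffAt.comp w (contMDiffAt_of_mem_maximalAtlas d'.chart_mem (hBd' hw))
        (d.contMDiffAt_param (hBd hw))
    have h2 : ContDiffAt ℂ ω g ((d'.chart ∘ d.param) w) := by fun_prop
    exact (h2.comp w (contMDiffAt_iff_contDiffAt.1 h1)).analyticAt
  have h0 : g ∘ d'.chart ∘ d.param =ᶠ[𝓝 v] 0 := by
    have : map d.param (𝓝 v) ≤ 𝓝[d'.slice] (d.param v) := by
      rw [d.map_param_nhds (hBd hv), heq]
    filter_upwards [this self_mem_nhdsWithin] with w hw
    exact sub_eq_zero.2 hw.2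
  intro w hw
  exact ⟨hBd' hw, sub_eq_zero.1 (hg.eqOn_zero_of_preconnected_of_eventuallyEq_zero hB hv h0 hw)⟩

/-! ### Immersions in adapted charts -/

/-- A chart `c` of a manifold `M` is adapted to `φ : M → M₀` and the slice chart `d` if `φ` maps
the source of `c` into the slice and `c` is the composition of `φ` with the coordinate map. -/
def IsAdapted {M : Type*} [TopologicalSpace M] (c : OpenPartialHomeomorph M (CSpace n))
    (φ : M → M₀) : Prop :=
  ∀ y ∈ c.source, φ y ∈ d.slice ∧ d.coord (φ y) = c y

section Adapted

variable {d} {M : Type*} [TopologicalSpace M] {c : OpenPartialHomeomorph M (CSpace n)} {φ : M → M₀}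

theorem IsAdapted.eq_param (h : d.IsAdapted c φ) {y : M} (hy : y ∈ c.source) :
    φ y = d.param (c y) := by
  rw [← (h y hy).2, d.param_coord (h y hy).1]

theorem IsAdapted.mem_dom (h : d.IsAdapted c φ) {y : M} (hy : y ∈ c.source) : c y ∈ d.dom := by
  rw [← (h y hy).2]
  exact d.coord_mem (h y hy).1

theorem IsAdapted.injOn (h : d.IsAdapted c φ) : InjOn φ c.source := fun y hy z hz hyz ↦
  c.injOn hy hz (by rw [← (h y hy).2, ← (h z hz).2, hyz])

theorem IsAdapted.map_nhds (h : d.IsAdapted c φ) {y : M} (hy : y ∈ c.source) :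
    map φ (𝓝 y) = 𝓝[d.slice] (φ y) := by
  rw [h.eq_param hy, ← d.map_param_nhds (h.mem_dom hy), ← c.map_nhds_eq hy, map_map]
  refine Filter.map_congr ?_
  filter_upwards [c.open_source.mem_nhds hy] with z hz using h.eq_param hz

/-- A map with adapted charts around each point is an immersion. -/
theorem isHolomorphicImmersion_of_isAdapted [ChartedSpace (CSpace n) M]
    (h : ∀ x : M, ∃ (d : SliceChart N n M₀) (c : OpenPartialHomeomorph M (CSpace n)),
      c ∈ IsManifold.maximalAtlas 𝓘(ℂ, CSpace n) ω M ∧ x ∈ c.source ∧ d.IsAdapted c φ) :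
    IsHolomorphicImmersion n N φ := by
  -- The subtraction does not truncate: `A` below splits `ℂᴺ` as `ℂⁿ` times the kernel of `d.proj`.
  refine ⟨CSpace (N - n), inferInstance, inferInstance, fun x ↦ ?_⟩
  obtain ⟨d, c, hc, hx, had⟩ := h x
  let A := (ContinuousLinearEquiv.equivOfRightInverse d.proj d.incl d.proj_incl).symm
  have hrank : Module.finrank ℂ (CSpace (N - n)) = Module.finrank ℂ d.proj.ker := by
    have := A.toLinearEquiv.finrank_eq
    simp only [Module.finrank_prod, finrank_euclideanSpace, Fintype.card_fin] at this
    simp only [finrank_euclideanSpace, Fintype.card_fin]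
    omega
  let B : CSpace (N - n) ≃L[ℂ] d.proj.ker := ContinuousLinearEquiv.ofFinrankEq hrank
  refine Manifold.IsImmersionAtOfComplement.mk_of_charts
    (((ContinuousLinearEquiv.refl ℂ _).prodCongr B).trans A) c d.chart hx (had x hx).1.1 hc
    d.chart_mem (fun y hy ↦ (had y hy).1.1) ?_
  intro v hv
  have hv' : v ∈ c.target := by simpa using hv
  have hy := c.map_target hv'
  have : d.chart (φ (c.symm v)) = d.incl v := by
    rw [← d.incl_coord (had _ hy).1, (had _ hy).2, c.right_inv hv']
  simpa [A] using this

/-- An immersion has adapted charts around each point. -/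
theorem exists_isAdapted [ChartedSpace (CSpace n) M] (hφ : IsHolomorphicImmersion n N φ) (x : M) :
    ∃ (d : SliceChart N n M₀) (c : OpenPartialHomeomorph M (CSpace n)),
      c ∈ IsManifold.maximalAtlas 𝓘(ℂ, CSpace n) ω M ∧ x ∈ c.source ∧ d.IsAdapted c φ := by
  have h := hφ.isImmersionAt x
  have H := h.isImmersionAtOfComplement_complement
  have hch : ∀ y ∈ H.domChart.source, H.codChart (φ y) = H.equiv (H.domChart y, 0) := by
    intro y hy
    have hy' : H.domChart y ∈ (H.domChart.extend 𝓘(ℂ, CSpace n)).target := by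
      simpa using H.domChart.map_source hy
    have := H.writtenInCharts hy'
    simpa [H.domChart.left_inv hy] using this
  let d : SliceChart N n M₀ :=
    { chart := H.codChart
      chart_mem := H.codChart_mem_maximalAtlas
      incl := H.equiv.toContinuousLinearMap.comp (ContinuousLinearMap.inl ℂ _ _)
      proj := (ContinuousLinearMap.fst ℂ _ _).comp H.equiv.symm.toContinuousLinearMap
      proj_incl := fun v ↦ by simp
      center := φ x
      center_mem_source := H.mem_codChart_source
      incl_proj_center := by simp [hch x H.mem_domChart_source] }
  refine ⟨d, H.domChart, H.domChart_mem_maximalAtlas, H.mem_domChart_source, fun y hy ↦ ?_⟩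
  refine ⟨⟨H.source_subset_preimage_source hy, ?_⟩, ?_⟩
  · simp [d, hch y hy]
  · simp [d, coord, hch y hy]

end Adapted

/-- A complex submanifold is a slice near each of its points. -/
theorem exists_source_inter_eq_slice {S : Set M₀} (hS : IsComplexSubmanifold N n S) {p : M₀}
    (hp : p ∈ S) : ∃ d : SliceChart N n M₀, p ∈ d.slice ∧ d.chart.source ∩ S = d.slice := by
  obtain ⟨e, he, hpe, L, hL, heL⟩ := hS p hp
  let A : CSpace n ≃L[ℂ] L := ContinuousLinearEquiv.ofFinrankEq (by simp [hL])
  let i : CSpace n →L[ℂ] CSpace N := L.subtypeL.comp A.toContinuousLinearMap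
  obtain ⟨g, hg⟩ := LinearMap.exists_leftInverse_of_injective i.toLinearMap
    (LinearMap.ker_eq_bot.2 (Subtype.val_injective.comp A.injective))
  have hgi : ∀ v, g (i v) = v := fun v ↦ LinearMap.congr_fun hg v
  have hL' : ∀ z, z ∈ L ↔ i (g z) = z := by
    intro z
    constructor
    · intro hz
      have : i (A.symm ⟨z, hz⟩) = z := by simp [i]
      rw [← this, hgi]
    · intro hz
      rw [← hz]
      exact (A (g z)).2
  refine ⟨⟨e, he, i, LinearMap.toContinuousLinearMap g, hgi, p, hpe,
    (hL' _).1 ((heL p hpe).1 hp)⟩, ⟨hpe, (hL' _).1 ((heL p hpe).1 hp)⟩, ?_⟩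
  ext q
  exact and_congr_right fun hq ↦ (heL q hq).trans (hL' _)

end SliceChart

/-! ### The complex manifold of slice germs -/

/-- A germ of an `n`-dimensional slice of `M₀`, recorded as a point of `M₀` together with the filter
of neighbourhoods of that point within the slice. -/
@[ext]
structure SliceGerm (N n : ℕ) (M₀ : Type*) [TopologicalSpace M₀] [ChartedSpace (CSpace N) M₀] where
  pt : M₀
  nhds : Filter M₀
  exists_slice : ∃ d : SliceChart N n M₀, pt ∈ d.slice ∧ nhds = 𝓝[d.slice] pt

namespace SliceGerm

variable {N n : ℕ} {M₀ : Type u} [TopologicalSpace M₀] [ChartedSpace (CSpace N) M₀]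

open Classical in
/-- The germ of a slice at the point with given coordinates, with a default value outside the domain
of the coordinates. -/
noncomputable def ofCoord (d : SliceChart N n M₀) (v : CSpace n) : SliceGerm N n M₀ :=
  if h : v ∈ d.dom then ⟨d.param v, 𝓝[d.slice] (d.param v), d, d.param_mem h, rfl⟩
  -- The field `center` of a slice chart guarantees that such a germ exists.
  else ⟨d.center, 𝓝[d.slice] d.center, d, d.center_mem, rfl⟩

theorem ofCoord_pt {d : SliceChart N n M₀} {v : CSpace n} (h : v ∈ d.dom) :
    (ofCoord d v).pt = d.param v := by
  rw [ofCoord, dif_pos h]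

theorem ofCoord_nhds {d : SliceChart N n M₀} {v : CSpace n} (h : v ∈ d.dom) :
    (ofCoord d v).nhds = 𝓝[d.slice] (d.param v) := by
  rw [ofCoord, dif_pos h]

/-- The coordinates on the germs of a given slice. -/
noncomputable def partialEquiv (d : SliceChart N n M₀) :
    PartialEquiv (SliceGerm N n M₀) (CSpace n) where
  toFun g := d.coord g.pt
  invFun := ofCoord d
  source := {g | g.pt ∈ d.slice ∧ g.nhds = 𝓝[d.slice] g.pt}
  target := d.dom
  map_source' _ hg := d.coord_mem hg.1
  map_target' v hv := by
    rw [mem_ofPred_eq, ofCoord_pt hv, ofCoord_nhds hv]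
    exact ⟨d.param_mem hv, rfl⟩
  left_inv' g hg := by
    have h := d.coord_mem hg.1
    ext1
    · rw [ofCoord_pt h, d.param_coord hg.1]
    · rw [ofCoord_nhds h, d.param_coord hg.1, hg.2]
  right_inv' v hv := by rw [ofCoord_pt hv, d.coord_param hv]

theorem mem_partialEquiv_symm_trans_source {d d' : SliceChart N n M₀} {v : CSpace n} :
    v ∈ ((partialEquiv d).symm.trans (partialEquiv d')).source ↔
      v ∈ d.dom ∧ d.param v ∈ d'.slice ∧
        𝓝[d.slice] (d.param v) = 𝓝[d'.slice] (d.param v) := by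
  rw [PartialEquiv.trans_source]
  refine and_congr_right fun hv ↦ ?_
  change (ofCoord d v).pt ∈ d'.slice ∧ (ofCoord d v).nhds = 𝓝[d'.slice] (ofCoord d v).pt ↔ _
  rw [ofCoord_pt hv, ofCoord_nhds hv]

theorem eqOn_partialEquiv_symm_trans (d d' : SliceChart N n M₀) :
    EqOn ((partialEquiv d).symm.trans (partialEquiv d')) (d'.coord ∘ d.param)
      ((partialEquiv d).symm.trans (partialEquiv d')).source := by
  intro v hv
  change d'.coord (ofCoord d v).pt = _
  rw [ofCoord_pt (mem_partialEquiv_symm_trans_source.1 hv).1]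
  rfl

theorem contDiffOn_partialEquiv_symm_trans (d d' : SliceChart N n M₀) :
    ContDiffOn ℂ ω ((partialEquiv d).symm.trans (partialEquiv d'))
      ((partialEquiv d).symm.trans (partialEquiv d')).source := by
  refine ContDiffOn.congr (fun v hv ↦ ?_) (eqOn_partialEquiv_symm_trans d d')
  obtain ⟨h1, h2, -⟩ := mem_partialEquiv_symm_trans_source.1 hv
  exact (d.contDiffAt_transition d' h1 h2.1).contDiffWithinAt

/-- Two slices with the same germ at a point agree on a neighbourhood, hence have the same germ at
all nearby common points. -/
theorem isOpen_partialEquiv_symm_trans_source (d d' : SliceChart N n M₀) :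
    IsOpen ((partialEquiv d).symm.trans (partialEquiv d')).source := by
  rw [isOpen_iff_mem_nhds]
  intro v hv
  obtain ⟨h1, h2, h3⟩ := mem_partialEquiv_symm_trans_source.1 hv
  have h4 : ∀ᶠ q in 𝓝 (d.param v), d.slice =ᶠ[𝓝 q] d'.slice :=
    eventually_eventually_nhds.2 (nhdsWithin_eq_iff_eventuallyEq.1 h3)
  have hc : ContinuousAt d.param v := (d.contMDiffAt_param h1).continuousAt
  filter_upwards [hc.eventually h4, d.isOpen_dom.mem_nhds h1] with w hw hw'
  exact mem_partialEquiv_symm_trans_source.2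
    ⟨hw', hw.mem_iff.self_of_nhds.1 (d.param_mem hw'), nhdsWithin_eq_iff_eventuallyEq.2 hw⟩

variable (N n M₀) in
/-- The atlas on the space of slice germs given by the coordinates of all slices. -/
noncomputable def chartedSpaceCore : ChartedSpaceCore (CSpace n) (SliceGerm N n M₀) where
  atlas := range partialEquiv
  chartAt g := partialEquiv g.exists_slice.choose
  mem_chart_source g := g.exists_slice.choose_spec
  chart_mem_atlas g := mem_range_self _
  open_source := by
    rintro _ _ ⟨d, rfl⟩ ⟨d', rfl⟩
    exact isOpen_partialEquiv_symm_trans_source d d'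
  continuousOn_toFun := by
    rintro _ _ ⟨d, rfl⟩ ⟨d', rfl⟩
    exact (contDiffOn_partialEquiv_symm_trans d d').continuousOn

noncomputable instance : TopologicalSpace (SliceGerm N n M₀) :=
  (chartedSpaceCore N n M₀).toTopologicalSpace

noncomputable instance : ChartedSpace (CSpace n) (SliceGerm N n M₀) :=
  (chartedSpaceCore N n M₀).toChartedSpace

/-- The chart of the space of slice germs given by the coordinates of a slice. -/
noncomputable def coordChart (d : SliceChart N n M₀) :
    OpenPartialHomeomorph (SliceGerm N n M₀) (CSpace n) :=
  (chartedSpaceCore N n M₀).openPartialHomeomorph (partialEquiv d) (mem_range_self d)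

theorem mem_coordChart_source {d : SliceChart N n M₀} {g : SliceGerm N n M₀} :
    g ∈ (coordChart d).source ↔ g.pt ∈ d.slice ∧ g.nhds = 𝓝[d.slice] g.pt := Iff.rfl

theorem coordChart_apply (d : SliceChart N n M₀) (g : SliceGerm N n M₀) :
    coordChart d g = d.coord g.pt := rfl

theorem mem_atlas_iff {c : OpenPartialHomeomorph (SliceGerm N n M₀) (CSpace n)} :
    c ∈ atlas (CSpace n) (SliceGerm N n M₀) ↔ ∃ d, c = coordChart d := by
  change c ∈ ⋃ (e : PartialEquiv (SliceGerm N n M₀) (CSpace n))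
    (he : e ∈ (chartedSpaceCore N n M₀).atlas), {_} ↔ _
  simp only [mem_iUnion, mem_singleton_iff]
  constructor
  · rintro ⟨_, ⟨d, rfl⟩, h⟩
    exact ⟨d, h⟩
  · rintro ⟨d, h⟩
    exact ⟨_, ⟨d, rfl⟩, h⟩

theorem isAdapted_coordChart (d : SliceChart N n M₀) : d.IsAdapted (coordChart d) pt :=
  fun _ hg ↦ ⟨hg.1, rfl⟩

theorem nhds_eq_map_pt (g : SliceGerm N n M₀) : map pt (𝓝 g) = g.nhds := by
  obtain ⟨d, hd⟩ := g.exists_slice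
  rw [(isAdapted_coordChart d).map_nhds (mem_coordChart_source.2 hd), hd.2]

instance : IsManifold 𝓘(ℂ, CSpace n) ω (SliceGerm N n M₀) := by
  refine isManifold_of_contDiffOn _ _ _ fun c c' hc hc' ↦ ?_
  obtain ⟨d, rfl⟩ := mem_atlas_iff.1 hc
  obtain ⟨d', rfl⟩ := mem_atlas_iff.1 hc'
  simpa using! contDiffOn_partialEquiv_symm_trans d d'

theorem coordChart_mem_maximalAtlas (d : SliceChart N n M₀) :
    coordChart d ∈ IsManifold.maximalAtlas 𝓘(ℂ, CSpace n) ω (SliceGerm N n M₀) :=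
  IsManifold.subset_maximalAtlas (mem_atlas_iff.2 ⟨d, rfl⟩)

theorem isHolomorphicImmersion_pt : IsHolomorphicImmersion n N (pt : SliceGerm N n M₀ → M₀) :=
  SliceChart.isHolomorphicImmersion_of_isAdapted fun g ↦
    ⟨_, _, coordChart_mem_maximalAtlas _, mem_coordChart_source.2 g.exists_slice.choose_spec,
      isAdapted_coordChart _⟩

theorem continuous_pt [IsManifold 𝓘(ℂ, CSpace N) ω M₀] :
    Continuous (pt : SliceGerm N n M₀ → M₀) :=
  (Manifold.IsImmersion.contMDiff isHolomorphicImmersion_pt).continuous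

/-- Germs at distinct points are separated by `pt`. For germs at the same point, a common germ in
the chosen neighbourhoods would force the slices to coincide near that point, by the identity
theorem on a ball. -/
instance [IsManifold 𝓘(ℂ, CSpace N) ω M₀] [T2Space M₀] : T2Space (SliceGerm N n M₀) := by
  refine ⟨fun g g' hne ↦ ?_⟩
  by_cases hpt : g.pt = g'.pt
  swap
  · obtain ⟨U, V, hU, hV, hgU, hgV, hUV⟩ := t2_separation hpt
    exact ⟨pt ⁻¹' U, pt ⁻¹' V, hU.preimage continuous_pt, hV.preimage continuous_pt, hgU, hgV,
      hUV.preimage _⟩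
  obtain ⟨d, hd⟩ := g.exists_slice
  obtain ⟨d', hd'⟩ := g'.exists_slice
  have hv := d.coord_mem hd.1
  have hsrc : d.dom ∩ d.param ⁻¹' d'.chart.source ∈ 𝓝 (d.coord g.pt) := by
    refine inter_mem (d.isOpen_dom.mem_nhds hv) ?_
    refine (d.contMDiffAt_param hv).continuousAt.preimage_mem_nhds
      (d'.chart.open_source.mem_nhds ?_)
    rw [d.param_coord hd.1, hpt]
    exact hd'.1.1
  obtain ⟨r, hr, hball⟩ := Metric.mem_nhds_iff.1 hsrc
  refine ⟨(coordChart d).source ∩ coordChart d ⁻¹' Metric.ball (d.coord g.pt) r,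
    (coordChart d').source, (coordChart d).isOpen_inter_preimage Metric.isOpen_ball,
    (coordChart d').open_source, ⟨mem_coordChart_source.2 hd, Metric.mem_ball_self hr⟩,
    mem_coordChart_source.2 hd', ?_⟩
  rw [disjoint_left]
  rintro a ⟨ha, har⟩ ha'
  rw [mem_coordChart_source] at ha ha'
  refine hne (SliceGerm.ext hpt ?_)
  have hmaps : MapsTo d.param (Metric.ball (d.coord g.pt) r) d'.slice := by
    refine d.mapsTo_slice_of_isPreconnected d' (convex_ball _ _).isPreconnected
      (fun w hw ↦ (hball hw).1) (fun w hw ↦ (hball hw).2) har ?_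
    rw [coordChart_apply, d.param_coord ha.1, ← ha.2, ha'.2]
  have hle : 𝓝[d.slice] g.pt ≤ 𝓝[d'.slice] g.pt := by
    refine le_inf nhdsWithin_le_nhds (le_principal_iff.2 ?_)
    have := d.map_param_nhds hv
    rw [d.param_coord hd.1] at this
    rw [← this]
    exact mem_map.2 (mem_of_superset (Metric.ball_mem_nhds _ hr) hmaps)
  rw [hd.2, hd'.2, ← hpt]
  exact d'.nhdsWithin_slice_eq_of_le d (hpt ▸ hd'.1) hd.1 hle

/-! ### Lifting immersions and submanifolds to germs -/

section Lift

variable {M₁ : Type*} [TopologicalSpace M₁] [ChartedSpace (CSpace n) M₁] {φ₁ : M₁ → M₀}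

/-- The map sending a point of an immersed manifold to the germ of the image at that point. -/
def lift (hφ : IsHolomorphicImmersion n N φ₁) (x : M₁) : SliceGerm N n M₀ where
  pt := φ₁ x
  nhds := map φ₁ (𝓝 x)
  exists_slice := by
    obtain ⟨d, c, -, hx, had⟩ := SliceChart.exists_isAdapted hφ x
    exact ⟨d, (had x hx).1, had.map_nhds hx⟩

theorem continuous_lift (hφ : IsHolomorphicImmersion n N φ₁) : Continuous (lift hφ) := by
  rw [continuous_iff_continuousAt]
  intro x
  obtain ⟨d, c, -, hx, had⟩ := SliceChart.exists_isAdapted hφ x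
  have hmem : ∀ y ∈ c.source, lift hφ y ∈ (coordChart d).source := fun y hy ↦
    mem_coordChart_source.2 ⟨(had y hy).1, had.map_nhds hy⟩
  rw [(coordChart d).continuousAt_iff_continuousAt_comp_left
    (mem_of_superset (c.open_source.mem_nhds hx) hmem)]
  refine (c.continuousAt hx).congr ?_
  filter_upwards [c.open_source.mem_nhds hx] with y hy using (had y hy).2.symm

/-- The germ of an immersed manifold at a point is the germ of any immersed manifold through which
it factors continuously. -/
theorem lift_comp {M : Type*} [TopologicalSpace M] [ChartedSpace (CSpace n) M] {φ : M → M₀}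
    (hφ : IsHolomorphicImmersion n N φ) (hφ₁ : IsHolomorphicImmersion n N φ₁) {x : M₁} {y : M}
    (hy : φ y = φ₁ x) (hle : map φ₁ (𝓝 x) ≤ map φ (𝓝 y)) : lift hφ₁ x = lift hφ y := by
  obtain ⟨d, c, -, hx, had⟩ := SliceChart.exists_isAdapted hφ₁ x
  obtain ⟨d', c', -, hy', had'⟩ := SliceChart.exists_isAdapted hφ y
  refine SliceGerm.ext hy.symm ?_
  change map φ₁ (𝓝 x) = map φ (𝓝 y)
  rw [had.map_nhds hx, had'.map_nhds hy', hy] at hle ⊢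
  exact d'.nhdsWithin_slice_eq_of_le d (hy ▸ (had' y hy').1) (had x hx).1 hle

end Lift

section Submanifold

variable {S : Set M₀}

/-- The germ of a submanifold at one of its points. -/
def ofSubmanifold (hS : IsComplexSubmanifold N n S) (p : S) : SliceGerm N n M₀ where
  pt := p
  nhds := 𝓝[S] p
  exists_slice := by
    obtain ⟨d, hp, hd⟩ := SliceChart.exists_source_inter_eq_slice hS p.2
    refine ⟨d, hp, ?_⟩
    rw [← hd, nhdsWithin_inter_of_mem
      (mem_nhdsWithin_of_mem_nhds (d.chart.open_source.mem_nhds hp.1))]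

theorem continuous_ofSubmanifold (hS : IsComplexSubmanifold N n S) :
    Continuous (ofSubmanifold hS) := by
  rw [continuous_iff_continuousAt]
  intro p
  obtain ⟨d, hp, hd⟩ := SliceChart.exists_source_inter_eq_slice hS p.2
  have hsrc : (Subtype.val ⁻¹' d.chart.source : Set S) ∈ 𝓝 p :=
    (d.chart.open_source.preimage continuous_subtype_val).mem_nhds hp.1
  have hmem : ∀ q ∈ (Subtype.val ⁻¹' d.chart.source : Set S),
      ofSubmanifold hS q ∈ (coordChart d).source := by
    intro q hq
    refine mem_coordChart_source.2 ⟨hd ▸ ⟨hq, q.2⟩, ?_⟩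
    change 𝓝[S] q.1 = 𝓝[d.slice] q.1
    rw [← hd, nhdsWithin_inter_of_mem
      (mem_nhdsWithin_of_mem_nhds (d.chart.open_source.mem_nhds hq))]
  rw [(coordChart d).continuousAt_iff_continuousAt_comp_left
    (mem_of_superset hsrc hmem)]
  exact (d.contMDiffAt_coord hp.1).continuousAt.comp continuous_subtype_val.continuousAt

end Submanifold

/-! ### Leaves and their universal property -/

instance : LocallyConnectedSpace (SliceGerm N n M₀) :=
  ChartedSpace.locallyConnectedSpace (CSpace n) _

/-- The leaf through a germ: its connected component in the space of germs. -/
def leaf (g : SliceGerm N n M₀) :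
    TopologicalSpace.Opens (SliceGerm N n M₀) :=
  ⟨connectedComponent g, isOpen_connectedComponent⟩

instance (g : SliceGerm N n M₀) : ConnectedSpace (leaf g) :=
  isConnected_iff_connectedSpace.1 isConnected_connectedComponent

/-- The immersion of a leaf. -/
def leafMap (g : SliceGerm N n M₀) (a : leaf g) : M₀ := a.1.pt

variable {g : SliceGerm N n M₀}

theorem exists_isAdapted_leafMap (a : leaf g) :
    ∃ (d : SliceChart N n M₀) (c : OpenPartialHomeomorph (leaf g) (CSpace n)),
      c ∈ IsManifold.maximalAtlas 𝓘(ℂ, CSpace n) ω (leaf g) ∧ a ∈ c.source ∧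
        d.IsAdapted c (leafMap g) := by
  obtain ⟨d, hd⟩ := mem_atlas_iff.1 (chart_mem_atlas (CSpace n) a.1)
  refine ⟨d, chartAt (CSpace n) a, IsManifold.chart_mem_maximalAtlas a,
    mem_chart_source (CSpace n) a, fun b hb ↦ ?_⟩
  have hb' : b.1 ∈ (coordChart d).source := by
    rw [← hd]
    simpa [TopologicalSpace.Opens.chartAt_eq] using hb
  refine ⟨hb'.1, ?_⟩
  change coordChart d b.1 = _
  rw [← hd]
  rfl

theorem isHolomorphicImmersion_leafMap : IsHolomorphicImmersion n N (leafMap g) :=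
  SliceChart.isHolomorphicImmersion_of_isAdapted exists_isAdapted_leafMap

theorem map_leafMap_nhds (a : leaf g) : map (leafMap g) (𝓝 a) = a.1.nhds := by
  rw [← nhds_eq_map_pt, ← map_nhds_subtype_coe_eq_nhds a.2 ((leaf g).isOpen.mem_nhds a.2), map_map]
  rfl

theorem lift_leafMap (a : leaf g) : lift isHolomorphicImmersion_leafMap a = a.1 :=
  SliceGerm.ext rfl (map_leafMap_nhds a)

variable [IsManifold 𝓘(ℂ, CSpace N) ω M₀]

theorem continuous_leafMap : Continuous (leafMap g) :=
  continuous_pt.comp continuous_subtype_val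

variable [T2Space M₀] [SecondCountableTopology M₀]

instance : SecondCountableTopology (leaf g) := by
  have : LocallyCompactSpace (leaf g) := ChartedSpace.locallyCompactSpace (CSpace n) _
  have : LocallyConnectedSpace (leaf g) := ChartedSpace.locallyConnectedSpace (CSpace n) _
  refine secondCountableTopology_of_locally_injective (continuous_leafMap (g := g)) fun a ↦ ?_
  obtain ⟨d, c, -, ha, had⟩ := exists_isAdapted_leafMap a
  exact ⟨c.source, c.open_source.mem_nhds ha, c.secondCountableTopology_source, had.injOn⟩

theorem isComplexManifold_leaf : IsComplexManifold n (leaf g) :=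
  ⟨inferInstance, inferInstance, inferInstance⟩

/-- An immersed manifold meeting the image of a leaf in a nonempty open set has the germ of the leaf
at some point, by the Baire category theorem. -/
theorem exists_lift_mem_leaf {M₁ : Type*} [TopologicalSpace M₁] [ChartedSpace (CSpace n) M₁]
    [T2Space M₁] {φ₁ : M₁ → M₀} (hφ₁ : IsHolomorphicImmersion n N φ₁) (hc : Continuous φ₁)
    {U₁ : Set M₁} (hU₁ : IsOpen U₁) (hne : U₁.Nonempty) (hsub : φ₁ '' U₁ ⊆ range (leafMap g)) :
    ∃ x, lift hφ₁ x ∈ leaf g := by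
  have : LocallyCompactSpace (leaf g) := ChartedSpace.locallyCompactSpace (CSpace n) _
  have : LocallyCompactSpace M₁ := ChartedSpace.locallyCompactSpace (CSpace n) _
  choose d c hcm hmem had using exists_isAdapted_leafMap (g := g)
  choose K hK hKc hKcomp using fun a ↦
    local_compact_nhds ((c a).open_source.mem_nhds (hmem a))
  obtain ⟨T, hT, hTun⟩ := TopologicalSpace.countable_cover_nhds hK
  have := hT.to_subtype
  have hclosed : ∀ a, IsClosed (φ₁ ⁻¹' (leafMap g '' K a)) := fun a ↦
    (((hKcomp a).image continuous_leafMap).isClosed).preimage hc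
  -- Countably many of these closed preimages cover `U₁`, so they cannot all be nowhere dense.
  obtain ⟨a, x, hx⟩ : ∃ a, (interior (φ₁ ⁻¹' (leafMap g '' K a))).Nonempty := by
    by_contra! hcon
    refine not_isMeagre_of_isOpen hU₁ hne
      (IsMeagre.mono ?_ (isMeagre_iUnion (f := fun a : T ↦ φ₁ ⁻¹' (leafMap g '' K a)) fun a ↦
        ((hclosed a).isNowhereDense_iff.2 (hcon a)).isMeagre))
    intro x hx
    obtain ⟨b, hb⟩ := hsub ⟨x, hx, rfl⟩
    obtain ⟨a, ha, hba⟩ := mem_iUnion₂.1 (hTun ▸ mem_univ b : b ∈ ⋃ a ∈ T, K a)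
    exact mem_iUnion.2 ⟨⟨a, ha⟩, b, hba, hb⟩
  obtain ⟨b, hbK, hb⟩ := interior_subset hx
  refine ⟨x, ?_⟩
  -- Near `x`, `φ₁` takes values in the single slice containing the image of `K a`. Its germ is
  -- therefore included in that of the leaf at `b`, hence equal to it.
  rw [lift_comp isHolomorphicImmersion_leafMap hφ₁ hb ?_, lift_leafMap]
  · exact b.2
  · rw [(had a).map_nhds (hKc a hbK), hb]
    refine tendsto_nhdsWithin_iff.2 ⟨hc.continuousAt, ?_⟩
    filter_upwards [mem_interior_iff_mem_nhds.1 hx] with y hy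
    obtain ⟨b', hb'K, hb'⟩ := hy
    rw [← hb']
    exact (had a b' (hKc a hb'K)).1

theorem isComplexLeafPair_leaf (g : SliceGerm N n M₀) :
    IsComplexLeafPair.{u, u, w} N n (leaf g) (leafMap g) := by
  refine ⟨isComplexManifold_leaf, inferInstance, isHolomorphicImmersion_leafMap, ?_⟩
  intro M₁ _ _ hM₁ _ φ₁ hφ₁ ⟨U₁, hU₁, hne, hsub⟩
  have := hM₁.t2
  have := hM₁.isManifold
  have hφ₁' : ContMDiff 𝓘(ℂ, CSpace n) 𝓘(ℂ, CSpace N) ω φ₁ := Manifold.IsImmersion.contMDiff hφ₁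
  obtain ⟨x, hx⟩ := exists_lift_mem_leaf hφ₁ hφ₁'.continuous hU₁ hne hsub
  have hmem : ∀ y, lift hφ₁ y ∈ leaf g := by
    intro y
    have h1 : lift hφ₁ y ∈ connectedComponent (lift hφ₁ x) :=
      (isPreconnected_range (continuous_lift hφ₁)).subset_connectedComponent (mem_range_self x)
        (mem_range_self y)
    rwa [← connectedComponent_eq hx] at h1
  refine ⟨fun y ↦ ⟨lift hφ₁ y, hmem y⟩, ⟨?_, rfl⟩, ?_⟩
  -- A continuous lift of a holomorphic map through an immersion is holomorphic.
  · exact (ContMDiff.iff_comp_isImmersion isHolomorphicImmersion_leafMap).2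
      ⟨(continuous_lift hφ₁).subtype_mk _, hφ₁'⟩
  · rintro ρ ⟨hρ, hφρ⟩
    funext y
    apply Subtype.ext
    have hρc : Continuous ρ := ContMDiff.continuous hρ
    -- Uniqueness: the point `ρ y` is its own germ, and continuity of `ρ` places the germ of `φ₁` at
    -- `y` inside it.
    rw [← lift_leafMap (ρ y)]
    refine (lift_comp isHolomorphicImmersion_leafMap hφ₁ (congrFun hφρ y).symm ?_).symm
    conv_lhs => rw [hφρ]
    rw [← map_map]
    exact map_mono hρc.continuousAt

end SliceGerm

theorem theorem1p2 (N n : ℕ) (M₀ : Type u) [TopologicalSpace M₀] [ChartedSpace (CSpace N) M₀]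
    (hM₀ : IsComplexManifold N M₀) (S : Set M₀) (hS : IsComplexSubmanifold N n S)
    (hS_conn : IsConnected S) :
    ∃ (M : Type u) (_ : TopologicalSpace M) (_ : ChartedSpace (CSpace n) M) (φ : M → M₀),
      IsLeafExtension.{u, u, w} N n S M φ := by
  have := hM₀.t2
  have := hM₀.secondCountable
  have := hM₀.isManifold
  obtain ⟨p, hp⟩ := hS_conn.nonempty
  have := isPreconnected_iff_preconnectedSpace.1 hS_conn.isPreconnected
  let g := SliceGerm.ofSubmanifold hS ⟨p, hp⟩
  refine ⟨SliceGerm.leaf g, inferInstance, inferInstance, SliceGerm.leafMap g,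
    SliceGerm.isComplexLeafPair_leaf g, fun q hq ↦ ?_⟩
  -- The germs of the connected set `S` form a connected set, so they all lie in one leaf.
  have hqg : SliceGerm.ofSubmanifold hS ⟨q, hq⟩ ∈ SliceGerm.leaf g :=
    (isPreconnected_range (SliceGerm.continuous_ofSubmanifold hS)).subset_connectedComponent
      (mem_range_self _) (mem_range_self _)
  exact ⟨⟨_, hqg⟩, rfl⟩
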